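/- Let $n\ge 0$ be an integer, let $R\ge 2^{n+5}$, and let $B_R=\{x\in\mathbb R^{n+1}:|x|<R\}$. Let $\Sigma=\Sigma^n\subset B_R$ be a nonempty smooth hypersurface, properly embedded in $B_R$ (so $\Sigma$ has no boundary in $B_R$, and $\Sigma\cap K$ is compact for every compact $K\subset B_R$), which is a self-shrinker, i.e. satisfies $\mathbf H+\tfrac{1}{2}x^\perp=0$ on $\Sigma$; here $\mathbf H$ is the mean curvature vector (the trace of the vector-valued second fundamental form $A$), and $x^\perp$ is the normal component of the position vector. Let $$L_\Sigma=\Delta_\Sigma-\frac{x}{2}\cdot\nabla_\Sigma+|A|^2+\frac12$$ be the stability operator, and let $$\lambda(L_\Sigma)=\inf\left\{\frac{-\int_\Sigma u\,(L_\Sigma u)\,e^{-|x|^2/4}\,d\mathcal H^n}{\int_\Sigma u^2\,e^{-|x|^2/4}\,d\mathcal H^n}\;:\;u\in C_c^\infty(\Sigma),\ u\not\equiv 0\right\}\in[-\infty,\infty)$$ be its first Dirichlet eigenvalue. Then $\lambda(L_\Sigma)<0$. -/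

import Mathlib

open MeasureTheory Metric Set
open scoped ContDiff InnerProductSpace

noncomputable section

namespace Shrinker

/-- Euclidean space `ℝ^(n+1)` with its standard inner product. -/
abbrev Space (n : ℕ) : Type := EuclideanSpace ℝ (Fin (n + 1))

variable {n : ℕ}

/-! ### Hypersurfaces -/

/-- `S` is a smooth embedded hypersurface of `ℝ^(n+1)` (without boundary): near each of its points
it is the zero set of a smooth function with nowhere vanishing differential. -/
def IsSmoothHypersurface (S : Set (Space n)) : Prop :=
  ∀ p ∈ S, ∃ (U : Set (Space n)) (f : Space n → ℝ), IsOpen U ∧ p ∈ U ∧ ContDiffOn ℝ ∞ f U ∧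
    (∀ x ∈ U, fderiv ℝ f x ≠ 0) ∧ S ∩ U = {x ∈ U | f x = 0}

/-- `S` is a smooth hypersurface properly embedded in the open set `B`: it is contained in `B`, and
the inclusion of `S` in `B` is a proper map (the part of `S` in a compact subset of `B` is
compact). -/
def IsProperlyEmbedded (S B : Set (Space n)) : Prop :=
  IsSmoothHypersurface S ∧ S ⊆ B ∧ ∀ K ⊆ B, IsCompact K → IsCompact (S ∩ K)

/-! ### Tangent spaces and differentiation along a hypersurface

Maps are differentiated along `S` by `fderivWithin ℝ f S p`. Its values on vectors that are tangent
to `S` at `p` depend only on the restriction of `f` to `S` (see `fderivWithin_eq_on_tangent`), and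
only such vectors are inserted below. -/

/-- The tangent space of `S` at `p`, a linear subspace of `ℝ^(n+1)`. -/
def tangent (S : Set (Space n)) (p : Space n) : Submodule ℝ (Space n) :=
  Submodule.span ℝ (tangentConeAt ℝ S p)

theorem fderivWithin_eq_on_tangent {F : Type*} [NormedAddCommGroup F] [NormedSpace ℝ F]
    {S : Set (Space n)} {p : Space n} {f g : Space n → F} {f' : Space n →L[ℝ] F}
    (hfg : EqOn f g S) (hp : p ∈ S) (hg : HasFDerivWithinAt g f' S p)
    {v : Space n} (hv : v ∈ tangent S p) : fderivWithin ℝ f S p v = f' v := by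
  have hf : HasFDerivWithinAt f f' S p := hg.congr hfg (hfg hp)
  have h := hf.differentiableWithinAt.hasFDerivWithinAt.unique_on hf
  exact LinearMap.eqOn_span (f := (fderivWithin ℝ f S p).toLinearMap) (g := f'.toLinearMap) h hv

/-- The orthogonal projection of `ℝ^(n+1)` onto the tangent space of `S` at `p`. -/
def tangentProj (S : Set (Space n)) (p : Space n) : Space n →L[ℝ] Space n :=
  (tangent S p).starProjection

/-- The component of the vector `v` normal to `S` at `p`. -/
def normalPart (S : Set (Space n)) (p v : Space n) : Space n :=
  v - tangentProj S p v

/-- An orthonormal basis of the tangent space of `S` at `p`. (All expressions below in which it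
occurs are traces, hence independent of the choice of the basis.) -/
def frame (S : Set (Space n)) (p : Space n) :
    OrthonormalBasis (Fin (Module.finrank ℝ (tangent S p))) ℝ (tangent S p) :=
  stdOrthonormalBasis ℝ (tangent S p)

/-- The gradient `∇_S u` along `S`: the tangent vector that represents the differential of `u`
along `S`. -/
def surfGrad (S : Set (Space n)) (u : Space n → ℝ) (p : Space n) : Space n :=
  tangentProj S p (gradientWithin u S p)

/-- The divergence along `S` of a vector field: `div_S X = ∑ i, ⟨D_{e_i} X, e_i⟩`, with `e_i` an
orthonormal basis of the tangent space. -/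
def surfDiv (S : Set (Space n)) (X : Space n → Space n) (p : Space n) : ℝ :=
  ∑ i, ⟪fderivWithin ℝ X S p (frame S p i : Space n), (frame S p i : Space n)⟫_ℝ

/-- The Laplace-Beltrami operator `Δ_S u = div_S (∇_S u)`. -/
def surfLaplacian (S : Set (Space n)) (u : Space n → ℝ) (p : Space n) : ℝ :=
  surfDiv S (surfGrad S u) p

/-! ### Curvature -/

/-- The vector valued second fundamental form `A(v, w) = (D_v W)^⊥` of `S` at `p`, where `v`, `w`
are tangent vectors and `W` is a tangential field extending `w`. Differentiating `W = P W`, with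
`P` the tangential projection, gives `(D_v P) w = D_v W - P (D_v W) = (D_v W)^⊥`. -/
def secondFF (S : Set (Space n)) (p v w : Space n) : Space n :=
  fderivWithin ℝ (tangentProj S) S p v w

/-- The mean curvature vector: the trace of the second fundamental form. (For a unit normal `N` it
is `-(div_S N) N`.) -/
def meanCurvature (S : Set (Space n)) (p : Space n) : Space n :=
  ∑ i, secondFF S p (frame S p i) (frame S p i)

/-- The squared norm `|A|^2` of the second fundamental form. -/
def normSqA (S : Set (Space n)) (p : Space n) : ℝ :=
  ∑ i, ∑ j, ‖secondFF S p (frame S p i) (frame S p j)‖ ^ 2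

/-- The self-shrinker equation `H + x^⊥ / 2 = 0` on `S`. -/
def IsSelfShrinker (S : Set (Space n)) : Prop :=
  ∀ x ∈ S, meanCurvature S x + (1 / 2 : ℝ) • normalPart S x x = 0

/-! ### The stability operator and its first Dirichlet eigenvalue -/

/-- The Gaussian weight `Φ(x) = exp (-|x|^2 / 4)`. -/
def weight (x : Space n) : ℝ := Real.exp (-‖x‖ ^ 2 / 4)

/-- The stability operator `L_S u = Δ_S u - (x / 2) · ∇_S u + |A|^2 u + u / 2`. -/
def stabilityOp (S : Set (Space n)) (u : Space n → ℝ) (x : Space n) : ℝ :=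
  surfLaplacian S u x - ⟪(1 / 2 : ℝ) • x, surfGrad S u x⟫_ℝ + normSqA S x * u x + (1 / 2) * u x

/-- The surface measure of `S`: the `n`-dimensional Hausdorff measure restricted to `S`. -/
def surfMeasure (S : Set (Space n)) : Measure (Space n) :=
  (Measure.euclideanHausdorffMeasure n).restrict S

/-- Dirichlet test functions on a hypersurface `S` properly embedded in `B`: smooth functions with
compact support in `B` that do not vanish identically on `S`. As `S` is properly embedded in `B`,
their restrictions to `S` are exactly the nonzero smooth functions with compact support on `S`. -/
def IsTestFunction (B S : Set (Space n)) (u : Space n → ℝ) : Prop :=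
  ContDiff ℝ ∞ u ∧ HasCompactSupport u ∧ tsupport u ⊆ B ∧ ∃ x ∈ S, u x ≠ 0

/-- The Rayleigh quotient `(-∫ u L_S u Φ) / (∫ u^2 Φ)` of the stability operator. -/
def rayleigh (S : Set (Space n)) (u : Space n → ℝ) : ℝ :=
  (-∫ x, u x * stabilityOp S u x * weight x ∂(surfMeasure S)) /
    ∫ x, u x ^ 2 * weight x ∂(surfMeasure S)

/-- The first Dirichlet eigenvalue `λ(L_S)` of the stability operator on a hypersurface `S` properly
embedded in `B`, i.e. the bottom of the Dirichlet spectrum of `-L_S` in `L^2(S, Φ)`: the infimum of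
the Rayleigh quotient over nonzero smooth functions with compact support on `S`. As `|A|` may be
unbounded, it is an extended real number. -/
def firstEigenvalue (B S : Set (Space n)) : EReal :=
  ⨅ (u : Space n → ℝ) (_ : IsTestFunction B S u), ((rayleigh S u : ℝ) : EReal)

end Shrinker

end

noncomputable section

namespace Shrinker

variable {n : ℕ}

open Filter Topology Measure

/-! One compactly supported function `u` with `L u > 0` wherever `u > 0` on the hypersurface already
makes the Rayleigh quotient negative, with no integration by parts. On an entire shrinker the
constant 1 has `L 1 = |A|^2 + 1/2 > 0`; here it is replaced by a radial bump `u = G(|x|^2)`, `G(s) =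
exp(-1/(1 - s/a))` for `s < a` and zero beyond.

For a shrinker, `L u = G' (2n - |x|^2) + 4 G'' |x^T|^2 + (|A|^2 + 1/2) G`
(`stabilityOp_comp_norm_sq`), so everything reduces to a one-variable inequality, valid as soon as
`a > 16n + 64` (`profile_strict_subsolution`). The large radius leaves room for such an `a` below
`R^2`; taking also `a > |p|^2` for some `p` in the hypersurface makes `u` nonzero there.

The rest justifies the integrals: the hypersurface has finite measure on compact pieces and positive
measure near each of its points, and `L u` is continuous along it. -/

theorem range_eq_top_of_ne_zero {E : Type*} [NormedAddCommGroup E] [NormedSpace ℝ E]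
    {f' : E →L[ℝ] ℝ} (hf' : f' ≠ 0) : f'.range = ⊤ :=
  LinearMap.range_eq_top.2 (LinearMap.surjective (by exact_mod_cast hf'))

theorem finrank_ker_of_ne_zero {E : Type*} [NormedAddCommGroup E] [NormedSpace ℝ E]
    [FiniteDimensional ℝ E] {f' : E →L[ℝ] ℝ} (hf' : f' ≠ 0) :
    Module.finrank ℝ f'.ker + 1 = Module.finrank ℝ E := by
  have h := LinearMap.finrank_range_add_finrank_ker f'.toLinearMap
  have h2 : Module.finrank ℝ f'.toLinearMap.range = 1 := by
    rw [range_eq_top_of_ne_zero hf']; simp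
  change Module.finrank ℝ f'.toLinearMap.ker + 1 = _
  omega

/-! ### Local structure of regular level sets. -/

section ImplicitFunction

variable {E : Type*} [NormedAddCommGroup E] [NormedSpace ℝ E] [CompleteSpace E]
  {S : Set E} {f : E → ℝ} {f' : E →L[ℝ] ℝ} {p : E}

/-- A regular level set has a local parametrization by the kernel of the differential. -/
theorem exists_parametrization (hf : HasStrictFDerivAt f f' p) (hf' : f' ≠ 0)
    (hS : ∀ᶠ x in 𝓝 p, x ∈ S ↔ f x = 0) (hp : p ∈ S) :
    ∃ φ : f'.ker → E, φ 0 = p ∧ HasStrictFDerivAt φ f'.ker.subtypeL 0 ∧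
      (∀ᶠ z in 𝓝 0, φ z ∈ S) ∧ ∀ t ∈ 𝓝 (0 : f'.ker), ∀ᶠ x in 𝓝 p, x ∈ S → x ∈ φ '' t := by
  have hr := range_eq_top_of_ne_zero hf'
  have hfp : f p = 0 := hS.self_of_nhds.1 hp
  have h0 : hf.implicitFunction f f' hr (f p) 0 = p := hf.implicitFunction_apply_image hr
  have hd := hf.to_implicitFunction hr
  refine ⟨hf.implicitFunction f f' hr (f p), h0, hd, ?_, fun t ht => ?_⟩
  · have hc : Tendsto (hf.implicitFunction f f' hr (f p)) (𝓝 0) (𝓝 p) := by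
      simpa only [h0] using hd.continuousAt.tendsto
    have h1 := (hf.map_implicitFunction_eq hr).curry_nhds.self_of_nhds
    filter_upwards [hc.eventually hS, h1] with z hz h2
    rw [hz, ← hfp]; exact h2
  · have hc : ContinuousAt (fun x => (hf.implicitToOpenPartialHomeomorph f f' hr x).snd) p :=
      ((hf.implicitToOpenPartialHomeomorph f f' hr).continuousAt
        (hf.mem_implicitToOpenPartialHomeomorph_source hr)).snd
    have hc' : Tendsto (fun x => (hf.implicitToOpenPartialHomeomorph f f' hr x).snd) (𝓝 p) (𝓝 0) := by
      simpa using hc.tendsto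
    filter_upwards [hc'.eventually ht, hf.eq_implicitFunction hr, hS] with x h1 h2 h3 hx
    refine ⟨_, h1, ?_⟩
    rwa [h3.1 hx, ← hfp] at h2

/-- Since `f` vanishes on `S`, both `f'` and 0 are derivatives of `f` within `S`, so they agree on
tangent vectors. Conversely the parametrization, whose derivative at 0 is the inclusion, carries the
kernel into the tangent cone. -/
theorem span_tangentConeAt_level (hf : HasStrictFDerivAt f f' p) (hf' : f' ≠ 0)
    (hS : ∀ᶠ x in 𝓝 p, x ∈ S ↔ f x = 0) (hp : p ∈ S) :
    Submodule.span ℝ (tangentConeAt ℝ S p) = f'.ker := by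
  apply le_antisymm
  · rw [Submodule.span_le]
    intro v hv
    have h1 : HasFDerivWithinAt f f' S p := hf.hasFDerivAt.hasFDerivWithinAt
    have h2 : HasFDerivWithinAt f (0 : E →L[ℝ] ℝ) S p := by
      refine (hasFDerivWithinAt_const (0 : ℝ) p S).congr_of_eventuallyEq ?_ (hS.self_of_nhds.1 hp)
      filter_upwards [mem_nhdsWithin_of_mem_nhds hS, self_mem_nhdsWithin] with x hx hxS
      exact hx.1 hxS
    simpa using h1.unique_on h2 hv
  · obtain ⟨φ, h0, hd, hm, -⟩ := exists_parametrization hf hf' hS hp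
    intro v hv
    apply Submodule.subset_span
    obtain ⟨t, ht, htS⟩ : ∃ t ∈ 𝓝 (0 : f'.ker), φ '' t ⊆ S :=
      ⟨_, hm, by rintro _ ⟨z, hz, rfl⟩; exact hz⟩
    have h1 := (hd.hasFDerivAt.hasFDerivWithinAt (s := t)).mapsTo_tangent_cone
    have h2 : (⟨v, hv⟩ : f'.ker) ∈ tangentConeAt ℝ t 0 := by
      rw [← univ_inter t, tangentConeAt_inter_nhds ht, tangentConeAt_univ]; trivial
    have h3 := h1 h2
    rw [h0] at h3
    exact tangentConeAt_mono htS h3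

end ImplicitFunction

/-! ### Hausdorff measure of regular level sets. -/

section Measure

variable {E : Type*} [NormedAddCommGroup E] [InnerProductSpace ℝ E] [FiniteDimensional ℝ E]
  [MeasurableSpace E] [BorelSpace E] {S : Set E} {f : E → ℝ} {f' : E →L[ℝ] ℝ} {p : E}

/-- Near `p` the level set lies in a Lipschitz image of a bounded piece of the kernel. -/
theorem exists_nhds_measure_lt_top (hf : HasStrictFDerivAt f f' p) (hf' : f' ≠ 0)
    (hS : ∀ᶠ x in 𝓝 p, x ∈ S ↔ f x = 0) (hp : p ∈ S) :
    ∃ V ∈ 𝓝 p, μHE[Module.finrank ℝ f'.ker] (S ∩ V) < ⊤ := by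
  obtain ⟨φ, -, hd, -, hφ⟩ := exists_parametrization hf hf' hS hp
  obtain ⟨K, s, hs, hK⟩ := hd.exists_lipschitzOnWith
  have ht : s ∩ closedBall 0 1 ∈ 𝓝 (0 : f'.ker) :=
    inter_mem hs (closedBall_mem_nhds 0 one_pos)
  refine ⟨_, hφ _ ht, ?_⟩
  have h1 : S ∩ {x | x ∈ S → x ∈ φ '' (s ∩ closedBall 0 1)} ⊆ φ '' (s ∩ closedBall 0 1) :=
    fun x hx => hx.2 hx.1
  have h2 : (μHE[Module.finrank ℝ f'.ker] : Measure f'.ker) (s ∩ closedBall 0 1) < ⊤ :=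
    (measure_mono inter_subset_right).trans_lt (isCompact_closedBall 0 1).measure_lt_top
  refine (measure_mono h1).trans_lt ?_
  have h3 := (hK.mono (inter_subset_left (t := closedBall 0 1))).hausdorffMeasure_image_le
    (d := Module.finrank ℝ f'.ker) (by positivity)
  have hc := addHaarScalarFactor_volume_hausdorffMeasure_ne_zero (Module.finrank ℝ f'.ker)
  rw [euclideanHausdorffMeasure_def] at h2 ⊢
  rw [Measure.smul_apply, ENNReal.smul_def, smul_eq_mul] at h2 ⊢
  refine ENNReal.mul_lt_top ENNReal.coe_lt_top (h3.trans_lt ?_)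
  refine ENNReal.mul_lt_top (ENNReal.rpow_lt_top_of_nonneg (by positivity) ENNReal.coe_ne_top) ?_
  exact ENNReal.lt_top_of_mul_ne_top_right h2.ne (by exact_mod_cast hc)

/-- Orthogonal projection to the kernel does not increase Hausdorff measure, and the projected piece
contains an open set: projection after parametrization has the identity as derivative. -/
theorem measure_inter_nhds_pos (hf : HasStrictFDerivAt f f' p) (hf' : f' ≠ 0)
    (hS : ∀ᶠ x in 𝓝 p, x ∈ S ↔ f x = 0) (hp : p ∈ S) {V : Set E} (hV : V ∈ 𝓝 p) :
    0 < μHE[Module.finrank ℝ f'.ker] (S ∩ V) := by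
  obtain ⟨φ, h0, hd, hm, -⟩ := exists_parametrization hf hf' hS hp
  have hV' : ∀ᶠ z in 𝓝 0, φ z ∈ V := by
    have : Tendsto φ (𝓝 0) (𝓝 p) := by simpa only [h0] using hd.continuousAt.tendsto
    exact this.eventually hV
  have hd2 : HasStrictFDerivAt (fun z => f'.ker.orthogonalProjectionOnto (φ z))
      ((ContinuousLinearEquiv.refl ℝ f'.ker : f'.ker ≃L[ℝ] f'.ker) : f'.ker →L[ℝ] f'.ker) 0 := by
    have := (f'.ker.orthogonalProjectionOnto.hasStrictFDerivAt (x := φ 0)).comp 0 hd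
    refine this.congr_fderiv ?_
    ext z
    simp
  have hn := hd2.map_nhds_eq_of_equiv
  have hi : f'.ker.orthogonalProjectionOnto '' (S ∩ V) ∈
      𝓝 (f'.ker.orthogonalProjectionOnto (φ 0)) := by
    rw [← hn, mem_map]
    filter_upwards [hm, hV'] with z h1 h2
    exact ⟨φ z, ⟨h1, h2⟩, rfl⟩
  have hpos : 0 < (μHE[Module.finrank ℝ f'.ker] : Measure f'.ker)
      (f'.ker.orthogonalProjectionOnto '' (S ∩ V)) := measure_pos_of_mem_nhds _ hi
  refine hpos.trans_le ?_
  simp only [euclideanHausdorffMeasure_def, Measure.smul_apply]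
  gcongr
  exact hausdorffMeasure_orthogonalProjectionOnto_le _ _ _ (Nat.cast_nonneg _)

end Measure

/-! ### Projections and Hilbert-Schmidt norms. -/

section LinearAlgebra

variable {E F : Type*} [NormedAddCommGroup E] [InnerProductSpace ℝ E]
  [NormedAddCommGroup F] [InnerProductSpace ℝ F]

/-- The projection along `w`, onto the orthogonal complement of `w` (for `w ≠ 0`). -/
def projAlong (w : E) : E →L[ℝ] E :=
  ContinuousLinearMap.id ℝ E - (‖w‖ ^ 2)⁻¹ • (innerSL ℝ w).smulRight w

theorem projAlong_apply (w v : E) : projAlong w v = v - (‖w‖ ^ 2)⁻¹ • ⟪w, v⟫_ℝ • w := by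
  simp [projAlong]

theorem inner_projAlong_left (w u v : E) : ⟪projAlong w u, v⟫_ℝ = ⟪u, projAlong w v⟫_ℝ := by
  simp only [projAlong_apply, inner_sub_left, inner_sub_right, inner_smul_left, inner_smul_right,
    RCLike.conj_to_real, real_inner_comm w u]
  ring

theorem contDiffAt_projAlong {w : E} (hw : w ≠ 0) : ContDiffAt ℝ ∞ (projAlong : E → E →L[ℝ] E) w := by
  unfold projAlong
  have h1 : ContDiffAt ℝ ∞ (fun w : E => (‖w‖ ^ 2)⁻¹) w :=
    (contDiff_norm_sq ℝ).contDiffAt.inv (by simpa using hw)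
  have h2 : ContDiffAt ℝ ∞ (fun w : E => (innerSL ℝ w).smulRight w) w :=
    ((innerSL ℝ (E := E)).contDiff.contDiffAt).smulRight contDiffAt_id
  exact contDiffAt_const.sub (h1.smul h2)

theorem starProjection_ker_innerSL {K : Submodule ℝ E} [K.HasOrthogonalProjection] {w : E}
    (hK : ∀ v, v ∈ K ↔ ⟪w, v⟫_ℝ = 0) (hw : w ≠ 0) : K.starProjection = projAlong w := by
  ext v
  refine Submodule.eq_starProjection_of_mem_of_inner_eq_zero ?_ ?_
  · rw [hK, projAlong_apply, inner_sub_right, inner_smul_right, inner_smul_right,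
      real_inner_self_eq_norm_sq]
    have : ‖w‖ ^ 2 ≠ 0 := by simpa using hw
    field_simp; ring
  · intro u hu
    rw [projAlong_apply, sub_sub_cancel, inner_smul_left, inner_smul_left, (hK u).1 hu]
    simp

/-- The squared Hilbert-Schmidt norm of `B` on a subspace, computed in a basis of the ambient space. -/
theorem sum_norm_sq_orthonormalBasis {ι κ : Type*} [Fintype ι] [Fintype κ] {K : Submodule ℝ E}
    [K.HasOrthogonalProjection] (e : OrthonormalBasis ι ℝ K) (b : OrthonormalBasis κ ℝ E)
    (B : E →ₗ[ℝ] F) :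
    ∑ i, ‖B (e i)‖ ^ 2 = ∑ j, ‖B (K.starProjection (b j))‖ ^ 2 := by
  classical
  have h1 : ∀ v : E, B (K.starProjection v) = ∑ i, ⟪(e i : E), v⟫_ℝ • B (e i) := by
    intro v
    have : K.starProjection v = ∑ i, ⟪(e i : E), v⟫_ℝ • (e i : E) := by
      have h := congrArg Subtype.val (e.sum_repr' (K.orthogonalProjectionOnto v))
      rw [Submodule.starProjection_apply, ← h, Submodule.coe_sum]
      refine Finset.sum_congr rfl fun i _ => ?_
      rw [Submodule.coe_smul, Submodule.inner_orthogonalProjectionOnto_eq_of_mem_left]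
    rw [this, _root_.map_sum]; simp
  -- Parseval in the ambient basis `b`, combined with orthonormality of `e`.
  have h2 : ∀ i i', ∑ j, ⟪(e i : E), b j⟫_ℝ * ⟪(e i' : E), b j⟫_ℝ = if i = i' then 1 else 0 := by
    intro i i'
    have h := b.sum_inner_mul_inner (e i : E) (e i')
    have h' := orthonormal_iff_ite.1 e.orthonormal i i'
    rw [← h', Submodule.coe_inner, ← h]
    exact Finset.sum_congr rfl fun j _ => by rw [real_inner_comm (e i' : E)]
  have h3 : ∀ j, ‖B (K.starProjection (b j))‖ ^ 2 =
      ∑ i, ∑ i', ⟪(e i : E), b j⟫_ℝ * ⟪(e i' : E), b j⟫_ℝ * ⟪B (e i), B (e i')⟫_ℝ := by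
    intro j
    rw [← real_inner_self_eq_norm_sq, h1, sum_inner]
    refine Finset.sum_congr rfl fun i _ => ?_
    rw [inner_sum]
    refine Finset.sum_congr rfl fun i' _ => ?_
    rw [inner_smul_left, inner_smul_right, RCLike.conj_to_real]; ring
  simp_rw [h3]
  rw [Finset.sum_comm]
  refine Finset.sum_congr rfl fun i _ => ?_
  rw [Finset.sum_comm]
  simp_rw [← Finset.sum_mul, h2]
  simp

end LinearAlgebra

/-! ### Calculus along a smooth hypersurface. -/

/-- Near a point of a smooth hypersurface, the tangential projection extends smoothly to a family of
symmetric operators on an open subset of the ambient space. -/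
theorem IsSmoothHypersurface.exists_extension {S : Set (Space n)} (hS : IsSmoothHypersurface S)
    {p : Space n} (hp : p ∈ S) :
    ∃ (U : Set (Space n)) (Q : Space n → Space n →L[ℝ] Space n), IsOpen U ∧ p ∈ U ∧
      ContDiffOn ℝ ∞ Q U ∧ (∀ x u v, ⟪Q x u, v⟫_ℝ = ⟪u, Q x v⟫_ℝ) ∧
      ∀ x ∈ S ∩ U, tangentProj S x = Q x := by
  obtain ⟨U, f, hU, hpU, hf, hf', hSU⟩ := hS p hp
  have hfa : ∀ x ∈ U, ContDiffAt ℝ ∞ f x := fun x hx => hf.contDiffAt (hU.mem_nhds hx)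
  have hgrad : ContDiffOn ℝ ∞ (gradient f) U :=
    (InnerProductSpace.toDual ℝ (Space n)).symm.contDiff.comp_contDiffOn
      ((contDiffOn_infty_iff_fderiv_of_isOpen hU).1 hf).2
  have hne : ∀ x ∈ U, gradient f x ≠ 0 := fun x hx h =>
    hf' x hx ((LinearIsometryEquiv.map_eq_zero_iff _).1 h)
  refine ⟨U, fun x => projAlong (gradient f x), hU, hpU, ?_,
    fun x => inner_projAlong_left _, fun x hx => ?_⟩
  · intro x hx
    exact (contDiffAt_projAlong (hne x hx)).comp_contDiffWithinAt x (hgrad x hx)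
  · have hx' : ∀ᶠ y in 𝓝 x, y ∈ S ↔ f y = 0 := by
      filter_upwards [hU.mem_nhds hx.2] with y hy
      simpa [hy] using Set.ext_iff.1 hSU y
    have ht : tangent S x = (fderiv ℝ f x).ker :=
      span_tangentConeAt_level ((hfa x hx.2).hasStrictFDerivAt (by simp)) (hf' x hx.2) hx' hx.1
    refine starProjection_ker_innerSL (fun v => ?_) (hne x hx.2)
    rw [ht, gradient, InnerProductSpace.toDual_symm_apply]
    rfl

theorem IsSmoothHypersurface.exists_strictFDeriv {S : Set (Space n)} (hS : IsSmoothHypersurface S)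
    {p : Space n} (hp : p ∈ S) :
    ∃ (f : Space n → ℝ) (f' : Space n →L[ℝ] ℝ), HasStrictFDerivAt f f' p ∧ f' ≠ 0 ∧
      ∀ᶠ x in 𝓝 p, x ∈ S ↔ f x = 0 := by
  obtain ⟨U, f, hU, hpU, hf, hf', hSU⟩ := hS p hp
  refine ⟨f, _, (hf.contDiffAt (hU.mem_nhds hpU)).hasStrictFDerivAt (by simp), hf' p hpU, ?_⟩
  filter_upwards [hU.mem_nhds hpU] with y hy
  simpa [hy] using Set.ext_iff.1 hSU y

theorem IsSmoothHypersurface.finrank_tangent {S : Set (Space n)} (hS : IsSmoothHypersurface S)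
    {p : Space n} (hp : p ∈ S) : Module.finrank ℝ (tangent S p) = n := by
  obtain ⟨f, f', h1, h2, h3⟩ := hS.exists_strictFDeriv hp
  have h := finrank_ker_of_ne_zero h2
  rw [tangent, span_tangentConeAt_level h1 h2 h3 hp]
  simpa using h

theorem IsSmoothHypersurface.exists_nhds_measure_lt_top {S : Set (Space n)}
    (hS : IsSmoothHypersurface S) {p : Space n} (hp : p ∈ S) :
    ∃ V ∈ 𝓝 p, (μHE[n] : Measure (Space n)) (S ∩ V) < ⊤ := by
  obtain ⟨f, f', h1, h2, h3⟩ := hS.exists_strictFDeriv hp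
  have h : Module.finrank ℝ f'.ker = n := by simpa using finrank_ker_of_ne_zero h2
  simpa only [h] using Shrinker.exists_nhds_measure_lt_top h1 h2 h3 hp

theorem IsSmoothHypersurface.measure_inter_nhds_pos {S : Set (Space n)}
    (hS : IsSmoothHypersurface S) {p : Space n} (hp : p ∈ S) {V : Set (Space n)} (hV : V ∈ 𝓝 p) :
    0 < (μHE[n] : Measure (Space n)) (S ∩ V) := by
  obtain ⟨f, f', h1, h2, h3⟩ := hS.exists_strictFDeriv hp
  have h : Module.finrank ℝ f'.ker = n := by simpa using finrank_ker_of_ne_zero h2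
  simpa only [h] using Shrinker.measure_inter_nhds_pos h1 h2 h3 hp hV

theorem fderivWithin_apply_of_eventuallyEq {F : Type*} [NormedAddCommGroup F] [NormedSpace ℝ F]
    {S : Set (Space n)} {p : Space n} {f g : Space n → F} {g' : Space n →L[ℝ] F}
    (hfg : f =ᶠ[𝓝[S] p] g) (hp : p ∈ S) (hg : HasFDerivAt g g' p)
    {v : Space n} (hv : v ∈ tangent S p) : fderivWithin ℝ f S p v = g' v := by
  rw [hfg.fderivWithin_eq_of_mem hp]
  exact fderivWithin_eq_on_tangent (eqOn_refl g S) hp hg.hasFDerivWithinAt hv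

theorem tangentProj_of_mem {S : Set (Space n)} {p v : Space n} (hv : v ∈ tangent S p) :
    tangentProj S p v = v :=
  Submodule.starProjection_eq_self_iff.2 hv

theorem tangentProj_mem (S : Set (Space n)) (p v : Space n) : tangentProj S p v ∈ tangent S p :=
  Submodule.starProjection_apply_mem _ _

theorem inner_tangentProj_left (S : Set (Space n)) (p v w : Space n) :
    ⟪tangentProj S p v, w⟫_ℝ = ⟪v, tangentProj S p w⟫_ℝ :=
  Submodule.inner_starProjection_left_eq_right _ _ _

theorem inner_tangentProj_self (S : Set (Space n)) (p v : Space n) :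
    ⟪v, tangentProj S p v⟫_ℝ = ‖tangentProj S p v‖ ^ 2 := by
  rw [← real_inner_self_eq_norm_sq, inner_tangentProj_left,
    tangentProj_of_mem (tangentProj_mem S p v)]

theorem norm_tangentProj_le (S : Set (Space n)) (p v : Space n) : ‖tangentProj S p v‖ ≤ ‖v‖ :=
  Submodule.norm_starProjection_apply_le _ _

theorem sum_inner_frame_sq (S : Set (Space n)) (p v : Space n) :
    ∑ i, ⟪v, (frame S p i : Space n)⟫_ℝ ^ 2 = ‖tangentProj S p v‖ ^ 2 := by
  have h := (frame S p).sum_sq_norm_inner_right ((tangent S p).orthogonalProjectionOnto v)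
  rw [tangentProj, Submodule.starProjection_apply]
  change _ = ‖(tangent S p).orthogonalProjectionOnto v‖ ^ 2
  rw [← h]
  refine Finset.sum_congr rfl fun i _ => ?_
  rw [Submodule.inner_orthogonalProjectionOnto_eq_of_mem_left, Real.norm_eq_abs, sq_abs,
    real_inner_comm]

theorem eventually_nhdsWithin_of_inter {S U : Set (Space n)} (hU : IsOpen U) {p : Space n}
    (hpU : p ∈ U) {P : Space n → Prop} (h : ∀ x ∈ S ∩ U, P x) : ∀ᶠ x in 𝓝[S] p, P x := by
  filter_upwards [mem_nhdsWithin_of_mem_nhds (hU.mem_nhds hpU), self_mem_nhdsWithin] with x h1 h2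
  exact h x ⟨h2, h1⟩

/-- `|A|^2` in terms of a smooth extension of the tangential projection. -/
theorem normSqA_eq {S U : Set (Space n)} {Q : Space n → Space n →L[ℝ] Space n} (hU : IsOpen U)
    (hQ : ContDiffOn ℝ ∞ Q U) (hQS : ∀ x ∈ S ∩ U, tangentProj S x = Q x) {x : Space n}
    (hx : x ∈ S ∩ U) :
    normSqA S x = ∑ i, ∑ j, ‖fderiv ℝ Q x (Q x (EuclideanSpace.basisFun _ ℝ i))
      (Q x (EuclideanSpace.basisFun _ ℝ j))‖ ^ 2 := by
  have hd : HasFDerivAt Q (fderiv ℝ Q x) x :=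
    ((hQ.contDiffAt (hU.mem_nhds hx.2)).differentiableAt (by simp)).hasFDerivAt
  have hs : ∀ v ∈ tangent S x, fderivWithin ℝ (tangentProj S) S x v = fderiv ℝ Q x v := fun v hv =>
    fderivWithin_apply_of_eventuallyEq (eventually_nhdsWithin_of_inter hU hx.2 hQS) hx.1 hd hv
  have h1 : ∀ v ∈ tangent S x, ∑ j, ‖secondFF S x v (frame S x j)‖ ^ 2 =
      ∑ j, ‖fderiv ℝ Q x v (Q x (EuclideanSpace.basisFun _ ℝ j))‖ ^ 2 := by
    intro v hv
    simp_rw [secondFF, hs v hv, ← hQS x hx]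
    exact sum_norm_sq_orthonormalBasis (frame S x) (EuclideanSpace.basisFun _ ℝ)
      (fderiv ℝ Q x v).toLinearMap
  rw [normSqA, Finset.sum_congr rfl fun i _ => h1 _ (frame S x i).2, Finset.sum_comm]
  conv_rhs => rw [Finset.sum_comm]
  refine Finset.sum_congr rfl fun j _ => ?_
  have h2 := sum_norm_sq_orthonormalBasis (frame S x) (EuclideanSpace.basisFun _ ℝ)
    ((fderiv ℝ Q x).flip (Q x (EuclideanSpace.basisFun _ ℝ j))).toLinearMap
  rw [← hQS x hx] at h2 ⊢
  exact h2

/-- The frame is chosen pointwise, with no continuity in the point; `normSqA_eq` trades it for a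
fixed ambient basis and a smooth `Q`. -/
theorem IsSmoothHypersurface.continuousOn_normSqA {S : Set (Space n)}
    (hS : IsSmoothHypersurface S) : ContinuousOn (normSqA S) S := by
  intro p hp
  obtain ⟨U, Q, hU, hpU, hQ, -, hQS⟩ := hS.exists_extension hp
  have hDQ : ContinuousAt (fderiv ℝ Q) p :=
    (((contDiffOn_infty_iff_fderiv_of_isOpen hU).1 hQ).2.continuousOn).continuousAt (hU.mem_nhds hpU)
  have hQc : ContinuousAt Q p := hQ.continuousOn.continuousAt (hU.mem_nhds hpU)
  have hc : ContinuousAt (fun x => ∑ i, ∑ j, ‖fderiv ℝ Q x (Q x (EuclideanSpace.basisFun _ ℝ i))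
      (Q x (EuclideanSpace.basisFun _ ℝ j))‖ ^ 2) p := by fun_prop
  exact hc.continuousWithinAt.congr_of_eventuallyEq
    (eventually_nhdsWithin_of_inter hU hpU fun x hx => normSqA_eq hU hQ hQS hx)
    (normSqA_eq hU hQ hQS ⟨hp, hpU⟩)

theorem IsSmoothHypersurface.continuousOn_tangentProj {S : Set (Space n)}
    (hS : IsSmoothHypersurface S) : ContinuousOn (tangentProj S) S := by
  intro p hp
  obtain ⟨U, Q, hU, hpU, hQ, -, hQS⟩ := hS.exists_extension hp
  exact (hQ.continuousOn.continuousAt (hU.mem_nhds hpU)).continuousWithinAt.congr_of_eventuallyEq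
    (eventually_nhdsWithin_of_inter hU hpU hQS) (hQS p ⟨hp, hpU⟩)

/-- The gradient within `S` is determined only up to normal vectors, which the projection kills. -/
theorem surfGrad_eq {S : Set (Space n)} {u : Space n → ℝ} {p w : Space n} (hp : p ∈ S)
    (hu : HasFDerivAt u (innerSL ℝ w) p) : surfGrad S u p = tangentProj S p w := by
  rw [surfGrad, ← sub_eq_zero, ← map_sub, tangentProj, Submodule.starProjection_apply_eq_zero_iff,
    Submodule.mem_orthogonal']
  intro v hv
  rw [inner_sub_left, gradientWithin, InnerProductSpace.toDual_symm_apply,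
    fderivWithin_eq_on_tangent (eqOn_refl u S) hp hu.hasFDerivWithinAt hv]
  simp

theorem hasFDerivAt_comp_norm_sq {G : ℝ → ℝ} {g : ℝ} {x : Space n}
    (hG : HasDerivAt G g (‖x‖ ^ 2)) :
    HasFDerivAt (fun y : Space n => G (‖y‖ ^ 2)) (innerSL ℝ ((2 * g) • x)) x := by
  refine (hG.comp_hasFDerivAt x (hasStrictFDerivAt_norm_sq x).hasFDerivAt).congr_fderiv ?_
  ext v
  simp
  ring

/-- The Laplacian of a function of `|x|^2` on a hypersurface. -/
theorem surfLaplacian_comp_norm_sq {S : Set (Space n)} (hS : IsSmoothHypersurface S)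
    {G G₁ G₂ : ℝ → ℝ} (hG : ∀ s, HasDerivAt G (G₁ s) s) (hG₁ : ∀ s, HasDerivAt G₁ (G₂ s) s)
    {p : Space n} (hp : p ∈ S) :
    surfLaplacian S (fun y => G (‖y‖ ^ 2)) p =
      2 * G₁ (‖p‖ ^ 2) * (⟪p, meanCurvature S p⟫_ℝ + n) +
        4 * G₂ (‖p‖ ^ 2) * ‖tangentProj S p p‖ ^ 2 := by
  obtain ⟨U, Q, hU, hpU, hQ, hsymm, hQS⟩ := hS.exists_extension hp
  have hd : HasFDerivAt Q (fderiv ℝ Q p) p :=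
    ((hQ.contDiffAt (hU.mem_nhds hpU)).differentiableAt (by simp)).hasFDerivAt
  set D := fderiv ℝ Q p
  have hff : ∀ v ∈ tangent S p, secondFF S p v v = D v v := fun v hv => by
    rw [secondFF, fderivWithin_apply_of_eventuallyEq
      (eventually_nhdsWithin_of_inter hU hpU hQS) hp hd hv]
  -- Differentiating the symmetry of `Q` moves `D v` from `p` onto `v`, which produces the second
  -- fundamental form.
  have hDsymm : ∀ v a b, ⟪D v a, b⟫_ℝ = ⟪a, D v b⟫_ℝ := by
    intro v a b
    have h1 : HasFDerivAt (fun x => ⟪b, Q x a⟫_ℝ)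
        ((innerSL ℝ b).comp ((ContinuousLinearMap.apply ℝ (Space n) a).comp D)) p :=
      (innerSL ℝ b).hasFDerivAt.comp p
        ((ContinuousLinearMap.apply ℝ (Space n) a).hasFDerivAt.comp p hd)
    have h2 : HasFDerivAt (fun x => ⟪a, Q x b⟫_ℝ)
        ((innerSL ℝ a).comp ((ContinuousLinearMap.apply ℝ (Space n) b).comp D)) p :=
      (innerSL ℝ a).hasFDerivAt.comp p
        ((ContinuousLinearMap.apply ℝ (Space n) b).hasFDerivAt.comp p hd)
    have h3 : (fun x => ⟪b, Q x a⟫_ℝ) = fun x => ⟪a, Q x b⟫_ℝ := by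
      funext x; rw [← hsymm, real_inner_comm]
    rw [h3] at h1
    have := congrArg (fun T => T v) (h1.unique h2)
    simpa [real_inner_comm] using this
  have hY : HasFDerivAt (fun y : Space n => (2 * G₁ (‖y‖ ^ 2)) • y)
      ((2 * G₁ (‖p‖ ^ 2)) • ContinuousLinearMap.id ℝ (Space n) +
        (2 • innerSL ℝ ((2 * G₂ (‖p‖ ^ 2)) • p)).smulRight p) p := by
    have h1 := (hasFDerivAt_comp_norm_sq (hG₁ (‖p‖ ^ 2))).const_mul 2
    refine (h1.smul (hasFDerivAt_id p)).congr_fderiv ?_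
    ext v
    simp
  have hX := hd.clm_apply hY
  have hgrad : surfGrad S (fun y => G (‖y‖ ^ 2)) =ᶠ[𝓝[S] p]
      fun y => Q y ((2 * G₁ (‖y‖ ^ 2)) • y) :=
    eventually_nhdsWithin_of_inter hU hpU fun x hx => by
      rw [surfGrad_eq hx.1 (hasFDerivAt_comp_norm_sq (hG _)), hQS x hx]
  have hterm : ∀ v ∈ tangent S p, ‖v‖ = 1 →
      ⟪fderivWithin ℝ (surfGrad S fun y => G (‖y‖ ^ 2)) S p v, v⟫_ℝ =
        2 * G₁ (‖p‖ ^ 2) * (⟪p, secondFF S p v v⟫_ℝ + 1) + 4 * G₂ (‖p‖ ^ 2) * ⟪p, v⟫_ℝ ^ 2 := by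
    intro v hv hv1
    have hQv : Q p v = v := by rw [← hQS p ⟨hp, hpU⟩, tangentProj_of_mem hv]
    rw [fderivWithin_apply_of_eventuallyEq hgrad hp hX hv, hff v hv, ← hDsymm]
    simp [inner_add_left, hQv, hsymm, inner_smul_left, hv1]
    ring
  rw [surfLaplacian, surfDiv, Finset.sum_congr rfl fun i _ => hterm _ (frame S p i).2
    ((frame S p).norm_eq_one i), Finset.sum_add_distrib, ← Finset.mul_sum,
    ← Finset.mul_sum, sum_inner_frame_sq, Finset.sum_add_distrib, ← inner_sum, meanCurvature]
  simp [hS.finrank_tangent hp]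

/-- The stability operator of a self-shrinker on functions of `|x|^2`. -/
theorem stabilityOp_comp_norm_sq {S : Set (Space n)} (hS : IsSmoothHypersurface S)
    (hshr : IsSelfShrinker S) {G G₁ G₂ : ℝ → ℝ} (hG : ∀ s, HasDerivAt G (G₁ s) s)
    (hG₁ : ∀ s, HasDerivAt G₁ (G₂ s) s) {p : Space n} (hp : p ∈ S) :
    stabilityOp S (fun y => G (‖y‖ ^ 2)) p =
      G₁ (‖p‖ ^ 2) * (2 * n - ‖p‖ ^ 2) + 4 * G₂ (‖p‖ ^ 2) * ‖tangentProj S p p‖ ^ 2 +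
        (normSqA S p + 1 / 2) * G (‖p‖ ^ 2) := by
  -- The curvature term contributes `-|p^⊥|^2 G'` and the drift `-|p^T|^2 G'`; together they give
  -- `-|p|^2 G'`.
  have hH : ⟪p, meanCurvature S p⟫_ℝ = -(1 / 2) * (‖p‖ ^ 2 - ‖tangentProj S p p‖ ^ 2) := by
    rw [eq_neg_of_add_eq_zero_left (hshr p hp), normalPart, inner_neg_right, inner_smul_right,
      inner_sub_right, inner_tangentProj_self, real_inner_self_eq_norm_sq]
    ring
  rw [stabilityOp, surfLaplacian_comp_norm_sq hS hG hG₁ hp,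
    surfGrad_eq hp (hasFDerivAt_comp_norm_sq (hG _)), hH, map_smul, inner_smul_left,
    inner_smul_right, inner_tangentProj_self, RCLike.conj_to_real]
  ring

/-- Boundedness on a set of finite measure gives integrability, so the integral is not the default
value 0. -/
theorem setIntegral_pos_of_continuousOn {X : Type*} [TopologicalSpace X] [T2Space X]
    [MeasurableSpace X] [BorelSpace X] {μ : Measure X} {K : Set X} (hK : IsCompact K) (hμ : μ K < ⊤)
    {F : X → ℝ} (hF : ContinuousOn F K) (h0 : ∀ x ∈ K, 0 ≤ F x)
    (hpos : 0 < μ (Function.support F ∩ K)) : 0 < ∫ x in K, F x ∂μ := by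
  obtain ⟨C, hC⟩ := hK.exists_bound_of_continuousOn hF
  have : IsFiniteMeasure (μ.restrict K) := ⟨by simpa using hμ⟩
  have hint : IntegrableOn F K μ :=
    Integrable.of_bound (hF.aestronglyMeasurable_of_isCompact hK hK.measurableSet) C
      ((ae_restrict_iff' hK.measurableSet).2 (ae_of_all _ hC))
  rw [setIntegral_pos_iff_support_of_nonneg_ae ?_ hint]
  · exact hpos
  · exact (ae_restrict_iff' hK.measurableSet).2 (ae_of_all _ h0)

/-! ### The radial test function -/

/-- The radial profile of the test function: smooth, positive on `s < a` and zero on `s ≥ a`. -/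
def profile (a s : ℝ) : ℝ := expNegInvGlue (1 - s / a)

/-- The first derivative of `profile a`. -/
def profileDeriv (a s : ℝ) : ℝ := -(1 / a) * (((1 - s / a)⁻¹) ^ 2 * expNegInvGlue (1 - s / a))

/-- The second derivative of `profile a`. -/
def profileDeriv₂ (a s : ℝ) : ℝ :=
  (1 / a) ^ 2 * ((((1 - s / a)⁻¹) ^ 4 - 2 * ((1 - s / a)⁻¹) ^ 3) * expNegInvGlue (1 - s / a))

theorem hasDerivAt_one_sub_div (a s : ℝ) : HasDerivAt (fun s => 1 - s / a) (-(1 / a)) s :=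
  ((hasDerivAt_id s).div_const a).const_sub 1

theorem hasDerivAt_profile (a s : ℝ) : HasDerivAt (profile a) (profileDeriv a s) s := by
  have h := expNegInvGlue.hasDerivAt_polynomial_eval_inv_mul 1 (1 - s / a)
  refine HasDerivAt.congr_deriv
    (HasDerivAt.comp s (by simpa using h) (hasDerivAt_one_sub_div a s)) ?_
  simp [profileDeriv]
  ring

theorem hasDerivAt_profileDeriv (a s : ℝ) :
    HasDerivAt (profileDeriv a) (profileDeriv₂ a s) s := by
  -- The derivative of `q(w⁻¹) * expNegInvGlue w` replaces `q` by `X^2 (q - q')`, at `w = 0` too;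
  -- for `q = X^2` this is `X^4 - 2 X^3`.
  have h := expNegInvGlue.hasDerivAt_polynomial_eval_inv_mul (Polynomial.X ^ 2) (1 - s / a)
  simp only [Polynomial.eval_pow, Polynomial.eval_X] at h
  refine HasDerivAt.congr_deriv
    ((h.comp s (hasDerivAt_one_sub_div a s)).const_mul (-(1 / a))) ?_
  rw [profileDeriv₂]
  generalize (1 - s / a)⁻¹ = w
  simp
  ring

theorem contDiff_profile (a : ℝ) : ContDiff ℝ ∞ (profile a) :=
  expNegInvGlue.contDiff.comp (contDiff_const.sub (contDiff_id.div_const a))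

theorem continuous_profileDeriv (a : ℝ) : Continuous (profileDeriv a) :=
  continuous_iff_continuousAt.2 fun s => (hasDerivAt_profileDeriv a s).continuousAt

theorem continuous_profileDeriv₂ (a : ℝ) : Continuous (profileDeriv₂ a) := by
  have h := expNegInvGlue.continuous_polynomial_eval_inv_mul (Polynomial.X ^ 4 - 2 * Polynomial.X ^ 3)
  have h' : Continuous fun w : ℝ => ((w⁻¹) ^ 4 - 2 * (w⁻¹) ^ 3) * expNegInvGlue w := by
    simpa using h
  exact continuous_const.mul (h'.comp (by fun_prop))

theorem profile_pos {a s : ℝ} (ha : 0 < a) (hs : s < a) : 0 < profile a s :=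
  expNegInvGlue.pos_of_pos (by rw [sub_pos, div_lt_one ha]; exact hs)

theorem profile_eq_zero {a s : ℝ} (ha : 0 < a) (hs : a ≤ s) : profile a s = 0 :=
  expNegInvGlue.zero_of_nonpos (by rw [sub_nonpos, one_le_div ha]; exact hs)

/-- The profile is a strict subsolution of the radial stability equation. -/
theorem profile_strict_subsolution {a s τ A N : ℝ} (hN : 0 ≤ N) (ha : 16 * N + 64 < a)
    (hs : s < a) (hτ : 0 ≤ τ) (hτs : τ ≤ s) (hA : 0 ≤ A) :
    0 < profileDeriv a s * (2 * N - s) + 4 * profileDeriv₂ a s * τ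
      + (A + 1 / 2) * profile a s := by
  have ha0 : 0 < a := by linarith
  obtain ⟨w, hw⟩ : ∃ w, w = 1 - s / a := ⟨_, rfl⟩
  have hsw : s = a * (1 - w) := by rw [hw]; field_simp; ring
  have hw0 : 0 < w := by rw [hw, sub_pos, div_lt_one ha0]; exact hs
  have hw1 : w ≤ 1 := by
    rw [hw]; linarith [div_nonneg (hτ.trans hτs) ha0.le]
  have hg : 0 < expNegInvGlue w := expNegInvGlue.pos_of_pos hw0
  have hfac : profileDeriv a s * (2 * N - s) + 4 * profileDeriv₂ a s * τ
      + (A + 1 / 2) * profile a s = expNegInvGlue w *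
        ((a * (1 - w) - 2 * N) / (a * w ^ 2) + 4 * τ * (1 - 2 * w) / (a ^ 2 * w ^ 4)
          + A + 1 / 2) := by
    rw [profileDeriv, profileDeriv₂, profile, ← hw, hsw]
    field_simp
    ring
  rw [hfac]
  refine mul_pos hg ?_
  rcases le_or_gt w (1 / 2) with h | h
  -- Outer region `s ≥ a / 2 > 2 N`: the profile is convex there, so no term is negative.
  · have h1 : 0 ≤ (a * (1 - w) - 2 * N) / (a * w ^ 2) :=
      div_nonneg (by nlinarith) (by positivity)
    have h2 : 0 ≤ 4 * τ * (1 - 2 * w) / (a ^ 2 * w ^ 4) :=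
      div_nonneg (mul_nonneg (by positivity) (by linarith)) (by positivity)
    linarith
  -- Inner region `s < a / 2`: the two bad terms cost at most `8 N / a` and `32 / a`, and `a > 16 N
  -- + 64` keeps their sum below the zeroth-order term `1 / 2`.
  · have hw2 : 1 / 4 ≤ w ^ 2 := by nlinarith
    have hw4 : 1 / 16 ≤ w ^ 4 := by nlinarith
    have h1 : -(8 * N / a) ≤ (a * (1 - w) - 2 * N) / (a * w ^ 2) := by
      rw [le_div_iff₀ (by positivity)]
      have e : -(8 * N / a) * (a * w ^ 2) = -(8 * N * w ^ 2) := by field_simp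
      rw [e]
      nlinarith [mul_nonneg hN (sub_nonneg.2 hw2), mul_nonneg ha0.le (sub_nonneg.2 hw1)]
    have h2 : -(32 / a) ≤ 4 * τ * (1 - 2 * w) / (a ^ 2 * w ^ 4) := by
      rw [le_div_iff₀ (by positivity)]
      have e : -(32 / a) * (a ^ 2 * w ^ 4) = -(32 * a * w ^ 4) := by field_simp
      rw [e]
      have h3 : τ * (2 * w - 1) ≤ a * (1 / 2) * 1 := by
        refine mul_le_mul ?_ (by linarith) (by linarith) (by positivity)
        nlinarith
      nlinarith [mul_nonneg ha0.le (sub_nonneg.2 hw4)]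
    have h3 : 8 * N / a + 32 / a < 1 / 2 := by
      rw [← add_div, div_lt_iff₀ ha0]; linarith
    linarith

/-! ### The Rayleigh quotient of the radial bump. -/

theorem isTestFunction_profile {a R : ℝ} (ha : 0 < a) (hR : 0 < R) (haR : a < R ^ 2)
    {S : Set (Space n)} {p : Space n} (hp : p ∈ S) (hpa : ‖p‖ ^ 2 < a) :
    IsTestFunction (ball 0 R) S (fun x => profile a (‖x‖ ^ 2)) := by
  have hsub : tsupport (fun x : Space n => profile a (‖x‖ ^ 2)) ⊆ closedBall 0 (√a) := by
    refine closure_minimal (fun x hx => ?_) isClosed_closedBall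
    rw [mem_closedBall_zero_iff]
    refine Real.le_sqrt_of_sq_le (le_of_not_gt fun h => hx (profile_eq_zero ha h.le))
  refine ⟨(contDiff_profile a).comp (contDiff_norm_sq ℝ), ?_, ?_, p, hp, (profile_pos ha hpa).ne'⟩
  · exact (isCompact_closedBall 0 (√a)).of_isClosed_subset (isClosed_tsupport _) hsub
  · exact hsub.trans (closedBall_subset_ball ((Real.sqrt_lt' hR).2 haR))

theorem normSqA_nonneg (S : Set (Space n)) (p : Space n) : 0 ≤ normSqA S p :=
  Finset.sum_nonneg fun _ _ => Finset.sum_nonneg fun _ _ => sq_nonneg _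

theorem weight_pos (x : Space n) : 0 < weight x := Real.exp_pos _

theorem continuous_weight : Continuous (weight : Space n → ℝ) := by
  unfold weight; fun_prop

theorem integral_surfMeasure_eq {S C : Set (Space n)} (hC : IsClosed C) {F : Space n → ℝ}
    (hF : ∀ x ∉ C, F x = 0) : ∫ x, F x ∂(surfMeasure S) = ∫ x in S ∩ C, F x ∂μHE[n] := by
  rw [surfMeasure, ← setIntegral_eq_integral_of_forall_compl_eq_zero hF,
    Measure.restrict_restrict hC.measurableSet, inter_comm]

theorem rayleigh_profile_neg {S : Set (Space n)} (hS : IsSmoothHypersurface S)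
    (hshr : IsSelfShrinker S) {a : ℝ} (ha : 16 * (n : ℝ) + 64 < a)
    (hK : IsCompact (S ∩ closedBall 0 (√a))) {p : Space n} (hp : p ∈ S) (hpa : ‖p‖ ^ 2 < a) :
    rayleigh S (fun x => profile a (‖x‖ ^ 2)) < 0 := by
  have ha0 : 0 < a := by have : (0 : ℝ) ≤ n := Nat.cast_nonneg n; linarith
  set u : Space n → ℝ := fun x => profile a (‖x‖ ^ 2) with hu
  have hu0 : ∀ x ∉ closedBall (0 : Space n) (√a), u x = 0 := fun x hx => by
    rw [mem_closedBall_zero_iff, not_le] at hx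
    exact profile_eq_zero ha0 (Real.lt_sq_of_sqrt_lt hx).le
  have hcu : Continuous u := ((contDiff_profile a).comp (contDiff_norm_sq ℝ)).continuous
  have hμ : (μHE[n] : Measure (Space n)) (S ∩ closedBall 0 (√a)) < ⊤ := by
    refine hK.measure_lt_top_of_nhdsWithin fun x hx => ?_
    obtain ⟨V, hV, hV'⟩ := hS.exists_nhds_measure_lt_top hx.1
    refine ⟨S ∩ V, inter_mem ?_ (mem_nhdsWithin_of_mem_nhds hV), hV'⟩
    exact mem_of_superset self_mem_nhdsWithin inter_subset_left
  have hL : ∀ x ∈ S, stabilityOp S u x = _ := fun x hx =>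
    stabilityOp_comp_norm_sq hS hshr (hasDerivAt_profile a) (hasDerivAt_profileDeriv a) hx
  have hLpos : ∀ x ∈ S, ‖x‖ ^ 2 < a → 0 < stabilityOp S u x := fun x hx hxa => by
    rw [hL x hx]
    refine profile_strict_subsolution (Nat.cast_nonneg n) ha hxa (sq_nonneg _) ?_
      (normSqA_nonneg S x)
    gcongr
    exact norm_tangentProj_le S x x
  have hLc : ContinuousOn (stabilityOp S u) S := by
    refine ContinuousOn.congr ?_ hL
    have h1 := hS.continuousOn_normSqA
    have h2 : ContinuousOn (fun x => tangentProj S x x) S :=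
      hS.continuousOn_tangentProj.clm_apply continuousOn_id
    have h3 := continuous_profileDeriv a
    have h4 := continuous_profileDeriv₂ a
    have h5 := (contDiff_profile a).continuous
    fun_prop
  have hupos : ∀ x, ‖x‖ ^ 2 < a → 0 < u x := fun x hx => profile_pos ha0 hx
  -- The open set `|x|^2 < a` is a neighbourhood of `p`, so it meets `S` in positive measure.
  have hVpos : ∀ F : Space n → ℝ, (∀ x ∈ S, ‖x‖ ^ 2 < a → 0 < F x) →
      0 < (μHE[n] : Measure (Space n)) (Function.support F ∩ (S ∩ closedBall 0 (√a))) := by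
    intro F hF
    have hV : {x : Space n | ‖x‖ ^ 2 < a} ∈ 𝓝 p :=
      (isOpen_lt (by fun_prop) continuous_const).mem_nhds hpa
    refine (hS.measure_inter_nhds_pos hp hV).trans_le (measure_mono fun x hx => ?_)
    refine ⟨(hF x hx.1 hx.2).ne', hx.1, ?_⟩
    rw [mem_closedBall_zero_iff]
    exact Real.le_sqrt_of_sq_le (le_of_lt hx.2)
  have hnum : 0 < ∫ x, u x * stabilityOp S u x * weight x ∂(surfMeasure S) := by
    rw [integral_surfMeasure_eq isClosed_closedBall fun x hx => by rw [hu0 x hx]; ring]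
    refine setIntegral_pos_of_continuousOn hK hμ ?_ ?_ (hVpos _ ?_)
    · exact ((hcu.continuousOn.mul hLc).mul continuous_weight.continuousOn).mono inter_subset_left
    · rintro x ⟨hx, -⟩
      rcases lt_or_ge (‖x‖ ^ 2) a with h | h
      · exact (mul_pos (mul_pos (hupos x h) (hLpos x hx h)) (weight_pos x)).le
      · rw [show u x = 0 from profile_eq_zero ha0 h]; simp
    · exact fun x hx h => mul_pos (mul_pos (hupos x h) (hLpos x hx h)) (weight_pos x)
  -- Strict positivity matters: division by zero would make the quotient 0.
  have hden : 0 < ∫ x, u x ^ 2 * weight x ∂(surfMeasure S) := by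
    rw [integral_surfMeasure_eq isClosed_closedBall fun x hx => by rw [hu0 x hx]; ring]
    refine setIntegral_pos_of_continuousOn hK hμ ?_ ?_ (hVpos _ ?_)
    · exact ((hcu.pow 2).mul continuous_weight).continuousOn
    · exact fun x _ => mul_nonneg (sq_nonneg _) (weight_pos x).le
    · exact fun x _ h => mul_pos (pow_pos (hupos x h) 2) (weight_pos x)
  rw [rayleigh]
  exact div_neg_of_neg_of_pos (neg_neg_of_pos hnum) hden

/-- The only use of the size of `R`; the argument needs just `R^2 > 16 n + 64`. -/
theorem linear_lt_two_pow (n : ℕ) : 16 * (n : ℝ) + 64 < ((2 : ℝ) ^ (n + 5)) ^ 2 := by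
  have h1 : (n : ℝ) < 2 ^ n := by exact_mod_cast n.lt_two_pow_self
  have h2 : (1 : ℝ) ≤ 2 ^ n := one_le_pow₀ (by norm_num)
  rw [pow_add]
  nlinarith

end Shrinker

end

theorem lemma3p3 (n : ℕ) (R : ℝ) (hR : (2 : ℝ) ^ (n + 5) ≤ R)
    (S : Set (Shrinker.Space n)) (hne : S.Nonempty)
    (hemb : Shrinker.IsProperlyEmbedded S (Metric.ball 0 R))
    (hshr : Shrinker.IsSelfShrinker S) :
    Shrinker.firstEigenvalue (Metric.ball 0 R) S < 0 := by
  obtain ⟨hS, hSB, hprop⟩ := hemb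
  obtain ⟨p, hp⟩ := hne
  have hR0 : 0 < R := lt_of_lt_of_le (by positivity) hR
  have hpR : ‖p‖ ^ 2 < R ^ 2 := by
    have : ‖p‖ < R := by simpa using hSB hp
    gcongr
  have hnR : 16 * (n : ℝ) + 64 < R ^ 2 := (Shrinker.linear_lt_two_pow n).trans_le (by gcongr)
  -- `a > |p|^2` makes the bump nonzero at `p`, `a > 16 n + 64` makes it a subsolution, and `a <
  -- R^2` keeps its support compact in the ball.
  obtain ⟨a, ha, haR⟩ := exists_between (max_lt hpR hnR)
  obtain ⟨hpa, hna⟩ := max_lt_iff.1 ha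
  have ha0 : 0 < a := by have : (0 : ℝ) ≤ n := Nat.cast_nonneg n; linarith
  have hK : IsCompact (S ∩ Metric.closedBall 0 (√a)) :=
    hprop _ (Metric.closedBall_subset_ball ((Real.sqrt_lt' hR0).2 haR)) (isCompact_closedBall 0 _)
  refine lt_of_le_of_lt (iInf₂_le _ (Shrinker.isTestFunction_profile ha0 hR0 haR hp hpa)) ?_
  exact_mod_cast Shrinker.rayleigh_profile_neg hS hshr hna hK hp hpa
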